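/- Let $R$ be a commutative Noetherian ring, $\mathfrak{a}$ an ideal of $R$, and $\mathcal{S}$ a Serre subcategory of the category of $R$-modules, i.e. a non-empty class of $R$-modules closed under taking submodules, quotients and extensions. Let $N$ be a finitely generated $\mathfrak{a}$-torsion $R$-module (every element of $N$ is annihilated by some power of $\mathfrak{a}$) and let $X$ be an arbitrary $R$-module. Let $H^i_{\mathfrak{a}}$ denote the $i$-th local cohomology functor, that is, the $i$-th right derived functor of the $\mathfrak{a}$-torsion functor $\Gamma_{\mathfrak{a}}(M)=\{m\in M : \mathfrak{a}^n m=0 \text{ for some } n\ge 0\}$. Let $s,t$ be non-negative integers such that (i) $\operatorname{Ext}^{s+t}_R(N,X)$ is in $\mathcal{S}$, (ii) $\operatorname{Ext}^{s+t+1-i}_R(N,H^i_{\mathfrak{a}}(X))$ is in $\mathcal{S}$ for all $i$ with $0\le i<t$, and (iii) $\operatorname{Ext}^{s+t-1-i}_R(N,H^i_{\mathfrak{a}}(X))$ is in $\mathcal{S}$ for all $i$ with $t+1\le i<s+t$. Then $\operatorname{Ext}^{s}_R(N,H^t_{\mathfrak{a}}(X))$ is in $\mathcal{S}$. -/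

import Mathlib

open CategoryTheory

universe u

namespace SerreLC

variable {R : Type u} [CommRing R]

/-- The `I`-torsion submodule `Γ_I(M) = {m ∈ M | I ^ n m = 0 for some n}` of an `R`-module `M`. -/
def gammaSubmodule (I : Ideal R) (M : Type u) [AddCommGroup M] [Module R M] :
    Submodule R M where
  carrier := {m | ∃ n : ℕ, ∀ r ∈ I ^ n, r • m = 0}
  zero_mem' := ⟨0, fun r _ => smul_zero r⟩
  add_mem' := by
    rintro x y ⟨n, hn⟩ ⟨k, hk⟩
    refine ⟨n + k, fun r hr => ?_⟩
    rw [smul_add, hn r (Ideal.pow_le_pow_right (Nat.le_add_right n k) hr),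
      hk r (Ideal.pow_le_pow_right (Nat.le_add_left k n) hr), add_zero]
  smul_mem' := by
    rintro c x ⟨n, hn⟩
    exact ⟨n, fun r hr => by rw [smul_comm, hn r hr, smul_zero]⟩

theorem map_mem_gammaSubmodule (I : Ideal R) {M M' : Type u} [AddCommGroup M] [Module R M]
    [AddCommGroup M'] [Module R M'] (f : M →ₗ[R] M') :
    ∀ m ∈ gammaSubmodule I M, f m ∈ gammaSubmodule I M' := by
  rintro m ⟨n, hn⟩
  exact ⟨n, fun r hr => by rw [← map_smul, hn r hr, map_zero]⟩

/-- `M` is `I`-torsion if `Γ_I(M) = M`. -/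
def IsIdealTorsion (I : Ideal R) (M : Type u) [AddCommGroup M] [Module R M] : Prop :=
  gammaSubmodule I M = ⊤

/-- The `I`-torsion functor `Γ_I`; on morphisms it is restriction. -/
def gamma (I : Ideal R) : ModuleCat.{u} R ⥤ ModuleCat.{u} R where
  obj M := ModuleCat.of R (gammaSubmodule I M)
  map f := ModuleCat.ofHom (f.hom.restrict (map_mem_gammaSubmodule I f.hom))

instance gamma_additive (I : Ideal R) : (gamma I).Additive where
  map_add := rfl

/-- The local cohomology module `H^i_I(M)`: the value at `M` of the `i`-th right derived functor
of the `I`-torsion functor `Γ_I`. -/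
noncomputable def H (I : Ideal R) (i : ℕ) (M : ModuleCat.{u} R) : ModuleCat.{u} R :=
  ((gamma I).rightDerived i).obj M

/-- `Ext^i_R(N, M)` as an `R`-module. -/
noncomputable def extModule (i : ℕ) (N M : ModuleCat.{u} R) : ModuleCat.{u} R :=
  ModuleCat.of R (Abelian.Ext.{u} N M i)

end SerreLC

/-! Let `L` be an injective resolution of `X` and `K = Γ(L)`. By Artin–Rees `K` again consists of
injectives; its homology is `H^i(X)`, and `Hom(N, K) = Hom(N, L)` because `N` is torsion. No
spectral sequence is needed: write `Z`, `B` for cycles and boundaries, and use `0 → B^t → Z^t → H^t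
→ 0` together with the dimension shift `Ext^{j+1}(N, B^{m+1}) ≅ Ext^{j+2}(N, Z^m)`.

For `s, t > 0`, `Ext^s(N, H^t)` lies between `Ext^s(N, Z^t)` and `Ext^{s+1}(N, B^t) ≅ Ext^{s+2}(N,
Z^{t-1})`. The latter reduces to (ii) by descending to `Z^0 = H^0`
(`prop_extModule_cycles_of_homology`). The former is pushed up by (iii) to `Ext^1(N, Z^{s+t-1}(K))`,
which embeds in `Ext^1(N, Z^{s+t-1}(L)) ≅ Ext^{s+t}(N, X)` (`prop_extModule_cycles_of_ext`). For `s
= 0` only the image of `Hom(N, Z^t)` in `Hom(N, H^t)` is controlled, which suffices. -/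

namespace SerreLC

/-! ### Torsion submodules of injective modules -/

section Torsion

variable {R : Type u} [CommRing R]

theorem exists_pow_smul_map_eq_zero (I : Ideal R) {M E : Type u} [AddCommGroup M] [Module R M]
    [Module.Finite R M] [AddCommGroup E] [Module R E] (f : M →ₗ[R] gammaSubmodule I E) :
    ∃ n : ℕ, ∀ r ∈ I ^ n, ∀ x, r • f x = 0 := by
  obtain ⟨s, hs⟩ := Module.Finite.fg_top (R := R) (M := M)
  choose n hn using fun x => (f x).2
  refine ⟨s.sup n, fun r hr x => ?_⟩
  have hx : x ∈ Submodule.span R (s : Set M) := hs ▸ Submodule.mem_top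
  induction hx using Submodule.span_induction with
  | mem x hx =>
    exact Subtype.ext (hn x r (Ideal.pow_le_pow_right (Finset.le_sup (f := n) hx) hr))
  | zero => simp
  | add x y _ _ hx hy => simp [hx, hy]
  | smul a x _ hx => rw [map_smul, smul_comm, hx, smul_zero]

/-- Over a Noetherian ring the torsion submodule of an injective module is injective. -/
theorem injective_gammaSubmodule [IsNoetherianRing R] (I : Ideal R) (E : Type u) [AddCommGroup E]
    [Module R E] [Module.Injective R E] : Module.Injective R (gammaSubmodule I E) := by
  refine Module.Baer.injective fun J g => ?_
  obtain ⟨n, hn⟩ := exists_pow_smul_map_eq_zero I g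
  -- Artin–Rees: `I ^ (k + n) ∩ J ⊆ I ^ n J`, which `g` kills, so `g` factors through the image of
  -- `J` in `R ⧸ I ^ (k + n)`.
  obtain ⟨k, hk⟩ := Ideal.exists_pow_inf_eq_pow_smul I (J : Submodule R R)
  set p : J →ₗ[R] R ⧸ I ^ (k + n) := (Submodule.mkQ (I ^ (k + n))).comp J.subtype with hp
  have hker : LinearMap.ker p ≤ LinearMap.ker ((gammaSubmodule I E).subtype.comp g) := by
    have hle : I ^ n • (⊤ : Submodule R J) ≤ LinearMap.ker g :=
      Submodule.smul_le.2 fun r hr x _ => by rw [LinearMap.mem_ker, map_smul, hn r hr]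
    intro x hx
    have hx' : (x : R) ∈ I ^ (k + n) :=
      (Submodule.Quotient.mk_eq_zero (I ^ (k + n))).1 hx
    have h1 : (x : R) ∈ I ^ (k + n) • (⊤ : Submodule R R) ⊓ J := ⟨by simpa using hx', x.2⟩
    rw [hk _ (Nat.le_add_right k n), Nat.add_sub_cancel_left] at h1
    have h2 : (x : R) ∈ (I ^ n • (⊤ : Submodule R J)).map J.subtype := by
      rw [Submodule.map_smul'', Submodule.map_top, Submodule.range_subtype]
      exact Submodule.smul_mono le_rfl inf_le_right h1
    obtain ⟨y, hy, hyx⟩ := h2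
    obtain rfl : y = x := Subtype.ext hyx
    have := hle hy
    rw [LinearMap.mem_ker] at this ⊢
    simp [this]
  obtain ⟨h, hh⟩ := Module.Injective.out (R := R) (Q := E) ((LinearMap.ker p).liftQ p le_rfl)
    (LinearMap.ker_eq_bot.1 (Submodule.ker_liftQ_eq_bot' _ _ rfl))
    ((LinearMap.ker p).liftQ _ hker)
  -- The extension is defined on `R ⧸ I ^ (k + n)`, so its values are killed by `I ^ (k + n)` and
  -- are torsion.
  refine ⟨(h.comp (Submodule.mkQ (I ^ (k + n)))).codRestrict _ fun x => ⟨k + n, fun r hr => ?_⟩,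
    fun x hx => Subtype.ext (hh (Submodule.Quotient.mk ⟨x, hx⟩))⟩
  rw [← map_smul, LinearMap.comp_apply, Submodule.mkQ_apply,
    (Submodule.Quotient.mk_eq_zero (I ^ (k + n)) (x := r • x)).2 (Ideal.mul_mem_right x _ hr),
    map_zero]

instance injective_gamma_obj [IsNoetherianRing R] (I : Ideal R) (E : ModuleCat.{u} R)
    [Injective E] : Injective ((gamma I).obj E) := by
  have : Module.Injective R E := Module.injective_module_of_injective_object R E
  have := injective_gammaSubmodule I E
  exact Module.injective_object_of_injective_module R (gammaSubmodule I E)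

/-- The inclusion of the `I`-torsion functor into the identity functor. -/
def gammaι (I : Ideal R) : gamma I ⟶ 𝟭 (ModuleCat.{u} R) where
  app M := ModuleCat.ofHom (gammaSubmodule I M).subtype

instance mono_gammaι_app (I : Ideal R) (M : ModuleCat.{u} R) : Mono ((gammaι I).app M) :=
  (ModuleCat.mono_iff_injective _).2 Subtype.val_injective

theorem exists_comp_gammaι (I : Ideal R) {N M : ModuleCat.{u} R} (hN : IsIdealTorsion I N)
    (f : N ⟶ M) : ∃ g : N ⟶ (gamma I).obj M, g ≫ (gammaι I).app M = f :=
  ⟨ModuleCat.ofHom (f.hom.codRestrict (gammaSubmodule I M) fun x =>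
    map_mem_gammaSubmodule I f.hom x (hN ▸ Submodule.mem_top)), rfl⟩

end Torsion

/-! ### Cycles, boundaries and homology of a cochain complex -/

section Cochain

open Limits HomologicalComplex

universe v w

variable {A : Type w} [Category.{v} A] [Abelian A] (K : CochainComplex A ℕ)

/-- The boundaries of a cochain complex, as the kernel of the projection of the cycles onto
the homology. -/
noncomputable def boundaries (m : ℕ) : A := kernel (K.homologyπ m)

/-- The map from a cochain complex to its boundaries induced by the differential. -/
noncomputable def toBoundaries (m : ℕ) : K.X m ⟶ boundaries K (m + 1) :=
  kernel.lift _ (K.toCycles m (m + 1)) (K.toCycles_comp_homologyπ m (m + 1))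

/-- The inclusion of the boundaries into the cycles. -/
noncomputable def boundariesToCycles (m : ℕ) : boundaries K m ⟶ K.cycles m :=
  kernel.ι (K.homologyπ m)

@[simp]
theorem toBoundaries_comp (m : ℕ) :
    toBoundaries K m ≫ boundariesToCycles K (m + 1) = K.toCycles m (m + 1) :=
  kernel.lift_ι _ _ _

instance (m : ℕ) : Mono (boundariesToCycles K m) :=
  inferInstanceAs (Mono (kernel.ι (K.homologyπ m)))

theorem exact_toCycles_homologyπ (m : ℕ) :
    (ShortComplex.mk _ _ (K.toCycles_comp_homologyπ m (m + 1))).Exact :=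
  ShortComplex.exact_of_g_is_cokernel _ (K.homologyIsCokernel m (m + 1) (by simp))

instance (m : ℕ) : Epi (toBoundaries K m) :=
  (exact_toCycles_homologyπ K m).epi_kernelLift

@[simp]
theorem iCycles_toCycles (m : ℕ) : K.iCycles m ≫ K.toCycles m (m + 1) = 0 := by
  simp [← cancel_mono (K.iCycles (m + 1))]

@[simp]
theorem iCycles_toBoundaries (m : ℕ) : K.iCycles m ≫ toBoundaries K m = 0 := by
  simp [← cancel_mono (boundariesToCycles K (m + 1))]

theorem shortExact_boundaries_cycles_homology (m : ℕ) :
    (ShortComplex.mk (boundariesToCycles K m) (K.homologyπ m) (kernel.condition _)).ShortExact where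
  exact := ShortComplex.exact_kernel _

/-- If `g` agrees with the differential up to a monomorphism, then the cycles are its kernel. -/
theorem exact_iCycles {m : ℕ} {Y : A} (g : K.X m ⟶ Y) (w : K.iCycles m ≫ g = 0)
    (i : Y ⟶ K.X (m + 1)) (h : g ≫ i = K.d m (m + 1)) :
    (ShortComplex.mk (K.iCycles m) g w).Exact :=
  ShortComplex.exact_of_f_is_kernel _ (KernelFork.IsLimit.ofι' _ _ fun k hk =>
    ⟨K.liftCycles k (m + 1) (by simp) (by rw [← h, reassoc_of% hk, zero_comp]), by simp⟩)

theorem shortExact_cycles_boundaries (m : ℕ) :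
    (ShortComplex.mk (K.iCycles m) (toBoundaries K m) (iCycles_toBoundaries K m)).ShortExact where
  exact := exact_iCycles K _ _ (boundariesToCycles K (m + 1) ≫ K.iCycles (m + 1))
    (by rw [reassoc_of% (toBoundaries_comp K m), toCycles_i])

theorem shortExact_cycles_cycles (m : ℕ) (h : K.ExactAt (m + 1)) :
    (ShortComplex.mk (K.iCycles m) (K.toCycles m (m + 1)) (iCycles_toCycles K m)).ShortExact where
  exact := exact_iCycles K _ _ (K.iCycles (m + 1)) (by simp)
  epi_g := (exact_toCycles_homologyπ K m).epi_f
    ((exactAt_iff_isZero_homology _ _).1 h |>.eq_of_tgt _ _)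

/-- The resolved object is the object of `0`-cycles of an injective resolution. -/
noncomputable def isoCyclesZero {X : A} (P : InjectiveResolution X) :
    X ≅ P.cocomplex.cycles 0 :=
  P.isLimitKernelFork.conePointUniqueUpToIso (P.cocomplex.cyclesIsKernel 0 1 (by simp))

end Cochain

/-! ### Serre classes and long exact sequences of Ext -/

section Ext

open Abelian

variable {R : Type u} [CommRing R] (S : ObjectProperty (ModuleCat.{u} R)) [S.IsSerreClass]

theorem prop_of_exact {A B C : Type u} [AddCommGroup A] [Module R A] [AddCommGroup B] [Module R B]
    [AddCommGroup C] [Module R C] (f : A →ₗ[R] B) (g : B →ₗ[R] C)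
    (h : ∀ b, g b = 0 ↔ ∃ a, f a = b) (hA : S (ModuleCat.of R A)) (hC : S (ModuleCat.of R C)) :
    S (ModuleCat.of R B) :=
  S.prop_X₂_of_exact (ModuleCat.shortComplex_exact
    (ModuleCat.shortComplexOfCompEqZero f g (LinearMap.ext fun a => (h _).2 ⟨a, rfl⟩)) h) hA hC

theorem prop_of_injective {A B : Type u} [AddCommGroup A] [Module R A] [AddCommGroup B]
    [Module R B] (f : A →ₗ[R] B) (hf : Function.Injective f) (hB : S (ModuleCat.of R B)) :
    S (ModuleCat.of R A) :=
  have := (ModuleCat.mono_iff_injective (ModuleCat.ofHom f)).2 hf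
  S.prop_of_mono (ModuleCat.ofHom f) hB

/-- The range of `g` is a quotient of `A ⧸ ker f`, which embeds in `B`. -/
theorem prop_range_of_ker_le {A B C : Type u} [AddCommGroup A] [Module R A] [AddCommGroup B]
    [Module R B] [AddCommGroup C] [Module R C] (f : A →ₗ[R] B) (g : A →ₗ[R] C)
    (h : ∀ a, f a = 0 → g a = 0) (hB : S (ModuleCat.of R B)) :
    S (ModuleCat.of R (LinearMap.range g)) := by
  have hA : S (ModuleCat.of R (A ⧸ LinearMap.ker f)) :=
    prop_of_injective S ((LinearMap.ker f).liftQ f le_rfl)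
      (LinearMap.ker_eq_bot.1 (Submodule.ker_liftQ_eq_bot' _ _ rfl)) hB
  have : Epi (ModuleCat.ofHom ((LinearMap.ker f).liftQ g.rangeRestrict
      fun a ha => Subtype.ext (h a ha))) := by
    refine (ModuleCat.epi_iff_surjective _).2 ?_
    rintro ⟨_, a, rfl⟩
    exact ⟨Submodule.Quotient.mk a, rfl⟩
  exact S.prop_of_epi (ModuleCat.ofHom ((LinearMap.ker f).liftQ g.rangeRestrict
      fun a ha => Subtype.ext (h a ha))) hA

variable (N : ModuleCat.{u} R)

theorem prop_extModule_of_iso {M M' : ModuleCat.{u} R} (e : M ≅ M') (j : ℕ)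
    (h : S (extModule j N M')) : S (extModule j N M) :=
  prop_of_injective S (Ext.postcompOfLinear (Ext.mk₀ e.hom) R N (add_zero j))
    (Function.LeftInverse.injective
      (g := Ext.postcompOfLinear (Ext.mk₀ e.inv) R N (add_zero j)) fun x => by simp) h

theorem prop_extModule_zero_of_mono {M M' : ModuleCat.{u} R} (f : M ⟶ M') [Mono f]
    (h : S (extModule 0 N M')) : S (extModule 0 N M) :=
  prop_of_injective S (Ext.postcompOfLinear (Ext.mk₀ f) R N (add_zero 0))
    (Ext.postcomp_mk₀_injective_of_mono N f) h

theorem prop_extModule_injective (E : ModuleCat.{u} R) [Injective E] (j : ℕ) :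
    S (extModule (j + 1) N E) :=
  have := Ext.subsingleton_of_injective N E j
  S.prop_of_isZero (ModuleCat.isZero_of_subsingleton (ModuleCat.of R (Ext.{u} N E (j + 1))))

section

variable {T : ShortComplex (ModuleCat.{u} R)} (hT : T.ShortExact)
include hT

theorem prop_extModule_X₂ (j : ℕ) (h₁ : S (extModule j N T.X₁)) (h₃ : S (extModule j N T.X₃)) :
    S (extModule j N T.X₂) :=
  prop_of_exact S (Ext.postcompOfLinear (Ext.mk₀ T.f) R N (add_zero j))
    (Ext.postcompOfLinear (Ext.mk₀ T.g) R N (add_zero j))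
    (fun x => ⟨Ext.covariant_sequence_exact₂ N hT x, by rintro ⟨y, rfl⟩; simp⟩) h₁ h₃

theorem prop_extModule_X₃ (j : ℕ) (h₂ : S (extModule j N T.X₂))
    (h₁ : S (extModule (j + 1) N T.X₁)) : S (extModule j N T.X₃) :=
  prop_of_exact S (Ext.postcompOfLinear (Ext.mk₀ T.g) R N (add_zero j))
    (Ext.postcompOfLinear hT.extClass R N rfl)
    (fun x => ⟨Ext.covariant_sequence_exact₃ N hT x rfl, by rintro ⟨y, rfl⟩; simp⟩) h₂ h₁

theorem prop_extModule_X₁ (j : ℕ) (h₃ : S (extModule j N T.X₃))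
    (h₂ : S (extModule (j + 1) N T.X₂)) : S (extModule (j + 1) N T.X₁) :=
  prop_of_exact S (Ext.postcompOfLinear hT.extClass R N rfl)
    (Ext.postcompOfLinear (Ext.mk₀ T.f) R N (add_zero (j + 1)))
    (fun x => ⟨fun h => Ext.covariant_sequence_exact₁ N hT x h rfl, by rintro ⟨y, rfl⟩; simp⟩)
    h₃ h₂

/-- Dimension shifting along a short exact sequence with injective middle term. -/
theorem prop_extModule_shift_iff [Injective T.X₂] (j : ℕ) :
    S (extModule (j + 2) N T.X₁) ↔ S (extModule (j + 1) N T.X₃) :=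
  ⟨prop_extModule_X₃ S N hT (j + 1) (prop_extModule_injective S N T.X₂ j),
    fun h => prop_extModule_X₁ S N hT (j + 1) h (prop_extModule_injective S N T.X₂ (j + 1))⟩

end

section

variable {T T' : ShortComplex (ModuleCat.{u} R)} (hT : T.ShortExact) (hT' : T'.ShortExact)
  (φ : T ⟶ T') (hφ : ∀ f : N ⟶ T'.X₂, ∃ g : N ⟶ T.X₂, g ≫ φ.τ₂ = f)
include hT' hφ

variable {N} in
/-- A morphism to `Z` whose connecting class dies in the target sequence factors through
`T.X₂`. -/
theorem exists_eq_mk₀_comp {Z : ModuleCat.{u} R} (i : T.X₃ ⟶ Z) (q : Z ⟶ T'.X₃) [Mono q]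
    (hi : i ≫ q = φ.τ₃) (a : Ext N Z 0)
    (ha : (a.comp (Ext.mk₀ q) (add_zero 0)).comp hT'.extClass (zero_add 1) = 0) :
    ∃ g : N ⟶ T.X₂, a = Ext.mk₀ (g ≫ T.g ≫ i) := by
  obtain ⟨b, hb⟩ := Ext.covariant_sequence_exact₃ N hT' _ (zero_add 1) ha
  obtain ⟨a, rfl⟩ := (Ext.mk₀_bijective N Z).2 a
  obtain ⟨b, rfl⟩ := (Ext.mk₀_bijective N T'.X₂).2 b
  obtain ⟨g, rfl⟩ := hφ b
  rw [Ext.mk₀_comp_mk₀, Ext.mk₀_comp_mk₀] at hb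
  refine ⟨g, congrArg _ ((cancel_mono q).1 ?_)⟩
  rw [← (Ext.mk₀_bijective _ _).1 hb]
  simp [hi, φ.comm₂₃]

include hT in
-- `Ext¹(N, T.X₁)` embeds in `Ext¹(N, T'.X₁)`. As `T.X₂` is injective, every class comes from some
-- `a : N ⟶ T.X₃`. If its image vanishes, `a ≫ φ.τ₃` lifts to `T'.X₂`, hence to `T.X₂` by `hφ`;
-- since `φ.τ₃` is mono, `a` itself lifts and its class is zero.
theorem prop_extModule_one_of_hom [Mono φ.τ₃] [Injective T.X₂] (h : S (extModule 1 N T'.X₁)) :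
    S (extModule 1 N T.X₁) := by
  refine prop_of_injective S (Ext.postcompOfLinear (Ext.mk₀ φ.τ₁) R N (add_zero 1)) ?_ h
  rw [← LinearMap.ker_eq_bot, LinearMap.ker_eq_bot']
  intro x hx
  obtain ⟨a, rfl⟩ := Ext.covariant_sequence_exact₁ N hT x (Ext.eq_zero_of_injective _) (zero_add 1)
  change (a.comp hT.extClass (zero_add 1)).comp (Ext.mk₀ φ.τ₁) (add_zero 1) = 0 at hx
  rw [Ext.comp_assoc_of_third_deg_zero, hT.extClass_naturality hT' φ,
    ← Ext.comp_assoc_of_second_deg_zero] at hx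
  obtain ⟨g, rfl⟩ := exists_eq_mk₀_comp hT' φ hφ (𝟙 _) φ.τ₃ (Category.id_comp _) a hx
  rw [Category.comp_id, ← Ext.mk₀_comp_mk₀,
    Ext.comp_assoc_of_second_deg_zero _ _ _ (zero_add 1), hT.comp_extClass, Ext.comp_zero]

/-- If `S` contains `Ext¹` of the first term of the target sequence, then it contains the image of
`Hom(N, Z)` in `Hom(N, H)` for every `Z ⟶ H` that vanishes on `T.X₃`. -/
theorem prop_range_postcomp {Z H : ModuleCat.{u} R} (i : T.X₃ ⟶ Z) (q : Z ⟶ T'.X₃) [Mono q]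
    (hi : i ≫ q = φ.τ₃) (p : Z ⟶ H) (hp : i ≫ p = 0) (h : S (extModule 1 N T'.X₁)) :
    S (ModuleCat.of R
      (LinearMap.range (Ext.postcompOfLinear (Ext.mk₀ p) R N (add_zero 0)))) := by
  refine prop_range_of_ker_le S
    (Ext.postcompOfLinear hT'.extClass R N (zero_add 1) ∘ₗ
      Ext.postcompOfLinear (Ext.mk₀ q) R N (add_zero 0)) _ (fun a ha => ?_) h
  obtain ⟨g, rfl⟩ := exists_eq_mk₀_comp hT' φ hφ i q hi a ha
  simp [hp]

end

end Ext
-- Comparison of the torsion complex with the resolution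
section LocalCohomology

open Abelian

variable {R : Type u} [CommRing R] (S : ObjectProperty (ModuleCat.{u} R)) [S.IsSerreClass]
  (N : ModuleCat.{u} R)

section Complex

variable {K L : CochainComplex (ModuleCat.{u} R) ℕ} [∀ m, Injective (K.X m)]

theorem prop_extModule_boundaries_iff (m j : ℕ) :
    S (extModule (j + 1) N (boundaries K (m + 1))) ↔ S (extModule (j + 2) N (K.cycles m)) :=
  (prop_extModule_shift_iff S N (shortExact_cycles_boundaries K m) j).symm

theorem prop_extModule_cycles_of_homology (m j : ℕ)
    (h : ∀ i ≤ m, S (extModule (j + 1 + m - i) N (K.homology i))) :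
    S (extModule (j + 1) N (K.cycles m)) := by
  induction m generalizing j with
  | zero => exact prop_extModule_of_iso S N K.isoHomologyπ₀ (j + 1) (h 0 le_rfl)
  | succ m ih =>
    refine prop_extModule_X₂ S N (shortExact_boundaries_cycles_homology K (m + 1)) (j + 1)
      ((prop_extModule_boundaries_iff S N m j).2 (ih (j + 1) fun i hi => ?_)) ?_
    · convert h i (by lia) using 2; lia
    · convert h (m + 1) le_rfl using 2; lia

/-- The morphism of short exact sequences from the boundaries sequence of `K` to the cycles
sequence of `L` induced by a morphism of complexes `K ⟶ L`. -/
noncomputable def boundariesHom (φ : K ⟶ L) (m : ℕ) :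
    ShortComplex.mk (K.iCycles m) (toBoundaries K m) (iCycles_toBoundaries K m) ⟶
      ShortComplex.mk (L.iCycles m) (L.toCycles m (m + 1)) (iCycles_toCycles L m) where
  τ₁ := HomologicalComplex.cyclesMap φ m
  τ₂ := φ.f m
  τ₃ := boundariesToCycles K (m + 1) ≫ HomologicalComplex.cyclesMap φ (m + 1)
  comm₂₃ := by simp [reassoc_of% (toBoundaries_comp K m), ← cancel_mono (L.iCycles (m + 1))]

instance (φ : K ⟶ L) [∀ m, Mono (φ.f m)] (m : ℕ) : Mono (boundariesHom φ m).τ₃ :=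
  mono_comp _ _

variable (φ : K ⟶ L) [∀ m, Mono (φ.f m)] (hφ : ∀ m (f : N ⟶ L.X m), ∃ g, g ≫ φ.f m = f)
  (hL : ∀ m, L.ExactAt (m + 1))
include hφ hL

/-- Each inductive step trades `Z^t` for `Z^{t+1}` in one lower Ext degree, at the cost of a term in
`H^{t+1}`; in degree one `K` is compared with `L`. -/
theorem prop_extModule_cycles_of_ext (s t : ℕ) (h : S (extModule 1 N (L.cycles (s + t))))
    (hH : ∀ i, t + 1 ≤ i → i < s + 1 + t → S (extModule (s + t - i) N (K.homology i))) :
    S (extModule (s + 1) N (K.cycles t)) := by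
  induction s generalizing t with
  | zero =>
    rw [zero_add] at h
    exact prop_extModule_one_of_hom S N (shortExact_cycles_boundaries K t)
      (shortExact_cycles_cycles L t (hL t)) (boundariesHom φ t) (hφ t) h
  | succ s ih =>
    rw [← prop_extModule_boundaries_iff S N t s]
    refine prop_extModule_X₁ S N (shortExact_boundaries_cycles_homology K (t + 1)) s ?_
      (ih (t + 1) ?_ fun i hi hi' => ?_)
    · convert hH (t + 1) le_rfl (by lia) using 2; lia
    · convert h using 3; lia
    · convert hH i (by lia) (by lia) using 2; lia

theorem prop_extModule_zero_homology_succ (t : ℕ) (h : S (extModule 1 N (L.cycles t)))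
    (h₂ : S (extModule 2 N (K.cycles t))) : S (extModule 0 N (K.homology (t + 1))) := by
  have hT := shortExact_boundaries_cycles_homology K (t + 1)
  refine prop_of_exact S
    -- `Hom(N, Z^{t+1})` itself need not lie in `S`; its image in `Hom(N, H^{t+1})` does, and
    -- exactness needs only that image.
    (LinearMap.range (Ext.postcompOfLinear (Ext.mk₀ (K.homologyπ (t + 1))) R N
      (add_zero 0))).subtype
    (Ext.postcompOfLinear hT.extClass R N rfl) (fun x => ⟨fun hx => ?_, ?_⟩)
    (prop_range_postcomp S N (shortExact_cycles_cycles L t (hL t)) (boundariesHom φ t) (hφ t)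
      (boundariesToCycles K (t + 1)) (HomologicalComplex.cyclesMap φ (t + 1)) rfl
      (K.homologyπ (t + 1)) (Limits.kernel.condition _) h)
    ((prop_extModule_boundaries_iff S N t 0).2 h₂)
  · exact ⟨⟨x, Ext.covariant_sequence_exact₃ N hT x rfl hx⟩, rfl⟩
  · rintro ⟨⟨_, y, rfl⟩, rfl⟩
    change (y.comp (Ext.mk₀ (K.homologyπ (t + 1))) (add_zero 0)).comp hT.extClass (zero_add 1) = 0
    rw [Ext.comp_assoc_of_second_deg_zero, hT.comp_extClass, Ext.comp_zero]

end Complex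

theorem prop_extModule_cycles_resolution {X : ModuleCat.{u} R} (P : InjectiveResolution X)
    (m j : ℕ) (h : S (extModule (j + 1 + m) N X)) :
    S (extModule (j + 1) N (P.cocomplex.cycles m)) := by
  induction m generalizing j with
  | zero => exact prop_extModule_of_iso S N (isoCyclesZero P).symm (j + 1) h
  | succ m ih =>
    have := P.injective m
    refine (prop_extModule_shift_iff S N
      (shortExact_cycles_cycles _ m (P.cocomplex_exactAt_succ m)) j).1 (ih (j + 1) ?_)
    convert h using 2; lia

end LocalCohomology

end SerreLC

theorem theorem2p3 {R : Type u} [CommRing R] [IsNoetherianRing R] (𝔞 : Ideal R)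
    (S : ObjectProperty (ModuleCat.{u} R)) [S.IsSerreClass]
    (N : ModuleCat.{u} R) [Module.Finite R N] (hN : SerreLC.IsIdealTorsion 𝔞 N)
    (X : ModuleCat.{u} R) (s t : ℕ)
    (h_total : S (SerreLC.extModule (s + t) N X))
    (h_low : ∀ i : ℕ, i < t → S (SerreLC.extModule (s + t + 1 - i) N (SerreLC.H 𝔞 i X)))
    (h_high : ∀ i : ℕ, t + 1 ≤ i → i < s + t →
      S (SerreLC.extModule (s + t - 1 - i) N (SerreLC.H 𝔞 i X))) :
    S (SerreLC.extModule s N (SerreLC.H 𝔞 t X)) := by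
  open SerreLC in
  let P := injectiveResolution X
  let L := P.cocomplex
  let K : CochainComplex (ModuleCat.{u} R) ℕ :=
    ((gamma 𝔞).mapHomologicalComplex (ComplexShape.up ℕ)).obj L
  let φ : K ⟶ L :=
    { f := fun m => (gammaι 𝔞).app (L.X m)
      comm' := fun i j _ => ((gammaι 𝔞).naturality (L.d i j)).symm }
  have hφ : ∀ m (f : N ⟶ L.X m), ∃ g, g ≫ φ.f m = f := fun m f => exists_comp_gammaι 𝔞 hN f
  have hmono : ∀ m, Mono (φ.f m) := fun m => mono_gammaι_app 𝔞 (L.X m)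
  have hinj : ∀ m, Injective (K.X m) := fun m =>
    have := P.injective m
    injective_gamma_obj 𝔞 (L.X m)
  have hL : ∀ m, L.ExactAt (m + 1) := P.cocomplex_exactAt_succ
  have e (i : ℕ) : H 𝔞 i X ≅ K.homology i := P.isoRightDerivedObj (gamma 𝔞) i
  have hlow : ∀ i < t, S (extModule (s + t + 1 - i) N (K.homology i)) := fun i hi =>
    prop_extModule_of_iso S N (e i).symm _ (h_low i hi)
  have hhigh : ∀ i, t + 1 ≤ i → i < s + t → S (extModule (s + t - 1 - i) N (K.homology i)) :=
    fun i hi hi' => prop_extModule_of_iso S N (e i).symm _ (h_high i hi hi')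
  refine prop_extModule_of_iso S N (e t) s ?_
  have hbdry : ∀ t', t = t' + 1 → S (extModule (s + 2) N (K.cycles t')) := fun t' ht =>
    prop_extModule_cycles_of_homology S N t' (s + 1) fun i hi => by
      convert hlow i (by lia) using 2; lia
  -- Dimension shifting needs positive Ext degree, so `s = 0` is separate.
  obtain _ | s := s
  · obtain _ | t := t
    -- `H^0 = Z^0(K)` embeds in `Z^0(L) ≅ X`, and `Hom(N, -)` is left exact.
    · exact prop_extModule_of_iso S N K.isoHomologyπ₀.symm 0
        (prop_extModule_zero_of_mono S N (HomologicalComplex.cyclesMap φ 0)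
          (prop_extModule_of_iso S N (isoCyclesZero P).symm 0 h_total))
    · refine prop_extModule_zero_homology_succ S N φ hφ hL t
        (prop_extModule_cycles_resolution S N P t 0 ?_) (hbdry t rfl)
      convert h_total using 2; lia
  · have hZ : S (extModule (s + 1) N (K.cycles t)) :=
      prop_extModule_cycles_of_ext S N φ hφ hL s t
        (prop_extModule_cycles_resolution S N P (s + t) 0 (by convert h_total using 2; lia))
        fun i hi hi' => by convert hhigh i hi (by lia) using 2; lia
    obtain _ | t := t
    · exact prop_extModule_of_iso S N K.isoHomologyπ₀.symm _ hZ
    · exact prop_extModule_X₃ S N (shortExact_boundaries_cycles_homology K (t + 1)) (s + 1) hZ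
        ((prop_extModule_boundaries_iff S N t (s + 1)).2 (hbdry t rfl))
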